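/- Let $\mathcal Y$ be a standard Borel space, $n\ge 0$, and let $\{P_\theta:\theta\in\Theta\}$, $\Theta\neq\emptyset$, be a family of probability measures on $\mathcal Y^n$ dominated by a $\sigma$-finite measure. Let $S:\mathcal Y^n\to\mathbb R^m$ be measurable (the conformity scores) with rank vector $R=(R_1,\dots,R_m)$, $R_i=\#\{j: S_j\le S_i\}$. Let $T$ be a rank-generated statistic: given the data, $T$ is drawn from $K(R,\cdot)$ for a fixed Markov kernel $K$ from rank vectors to a measurable space $\mathcal T$ (this includes $T=R$, any function of $R$, and randomized tie-breaking). Assume that $T$ is not sufficient for $\{P_\theta\}$, i.e. no single Markov kernel from $\mathcal T$ to $\mathcal Y^n$ is a conditional law of the data given $T$ under every $P_\theta$. For a finite action set $A$ and a loss $L:\Theta\times A\to[0,1]$, a procedure is a Markov kernel $\delta$ from $\mathcal Y^n$ to $A$, with risk $R_\theta(\delta)=\int\int L_\theta(a)\,\delta(da\mid y)\,P_\theta(dy)$. It is rank-based if it is obtained by drawing $T$ and then choosing the action by a Markov kernel from $\mathcal T$ to $A$. For a discrete prior $\pi$ on $\Theta$ put $r_\pi(\delta)=\sum_\theta\pi(\theta)R_\theta(\delta)$;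 $\delta$ is Bayes for $\pi$ if it minimizes $r_\pi$ among all procedures. $\delta$ dominates $\delta'$ if $R_\theta(\delta)\le R_\theta(\delta')$ for all $\theta$, with strict inequality for some $\theta$. A class of procedures is complete if every procedure outside it is dominated by one inside it; essentially complete if for every procedure outside it some procedure inside it has nowhere larger risk; minimal complete if it is complete and no proper subclass is complete. Then there exist a finite action set $A$ and a loss $L:\Theta\times A\to[0,1]$ such that the class of rank-based procedures is not essentially complete (hence not complete), and there exist a discrete prior $\pi$, a procedure $\rho$ that is Bayes for $\pi$, and a minimal complete class $\mathcal C$ with the following properties: 1. for some $\varepsilon>0$, $r_\pi(\rho)+\varepsilon\le r_\pi(\sigma)$ for every rank-based procedure $\sigma$; 2. $\rho\in\mathcal C$, and every member of $\mathcal C$ is Bayes for some prior supported in the support of $\pi$; 3. there is a rank-based procedure $\sigma$, not dominated by any rank-based procedure, such that $\sigma\notin\mathcal C$ and $\rho$ dominates $\sigma$. -/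

import Mathlib

open MeasureTheory ProbabilityTheory

namespace Conformal

/-! ### Decision theory for a statistical experiment `P : Θ → Measure X` -/

section Decision

variable {Θ X A : Type*} [MeasurableSpace X] [MeasurableSpace A]

/-- The family `P` is dominated by a single σ-finite measure. -/
def IsDominated (P : Θ → Measure X) : Prop :=
  ∃ μ : Measure X, SigmaFinite μ ∧ ∀ θ, P θ ≪ μ

/-- A (randomized) decision rule from observations in `X` to actions in `A`: a Markov kernel. -/
abbrev DecisionRule (X A : Type*) [MeasurableSpace X] [MeasurableSpace A] :=
  {δ : Kernel X A // IsMarkovKernel δ}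

/-- The risk function `R_θ(δ) = ∫ ∫ L_θ(a) δ(da | x) P_θ(dx)`. -/
noncomputable def risk (P : Θ → Measure X) (L : Θ → A → ℝ) (δ : DecisionRule X A) (θ : Θ) : ℝ :=
  ∫ x, ∫ a, L θ a ∂(δ.1 x) ∂(P θ)

/-- The average risk of `δ` under the (discrete) prior `π`. -/
noncomputable def priorRisk (P : Θ → Measure X) (L : Θ → A → ℝ) (π : PMF Θ)
    (δ : DecisionRule X A) : ℝ :=
  ∑' θ, (π θ).toReal * risk P L δ θ

/-- `δ` is a Bayes procedure for the prior `π`: it minimizes the average risk among all decision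
rules based on the full observation. -/
def IsBayesRule (P : Θ → Measure X) (L : Θ → A → ℝ) (π : PMF Θ) (δ : DecisionRule X A) : Prop :=
  ∀ δ' : DecisionRule X A, priorRisk P L π δ ≤ priorRisk P L π δ'

/-- `δ` dominates `δ'`: its risk is nowhere larger, and somewhere strictly smaller. -/
def Dominates (P : Θ → Measure X) (L : Θ → A → ℝ) (δ δ' : DecisionRule X A) : Prop :=
  (∀ θ, risk P L δ θ ≤ risk P L δ' θ) ∧ ∃ θ, risk P L δ θ < risk P L δ' θ

/-- Complete class: every rule outside the class is dominated by a rule in the class. -/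
def IsCompleteClass (P : Θ → Measure X) (L : Θ → A → ℝ) (C : Set (DecisionRule X A)) : Prop :=
  ∀ δ, δ ∉ C → ∃ δ' ∈ C, Dominates P L δ' δ

/-- Essentially complete class: for every rule outside the class, some rule in the class has
nowhere larger risk. Every complete class is essentially complete. -/
def IsEssentiallyCompleteClass (P : Θ → Measure X) (L : Θ → A → ℝ)
    (C : Set (DecisionRule X A)) : Prop :=
  ∀ δ, δ ∉ C → ∃ δ' ∈ C, ∀ θ, risk P L δ' θ ≤ risk P L δ θ

/-- Minimal complete class: a complete class, no proper subclass of which is complete. -/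
def IsMinimalCompleteClass (P : Θ → Measure X) (L : Θ → A → ℝ)
    (C : Set (DecisionRule X A)) : Prop :=
  IsCompleteClass P L C ∧ ∀ C' ⊆ C, IsCompleteClass P L C' → C' = C

end Decision

/-! ### Reductions of the data and sufficiency -/

section Reduction

variable {Θ X 𝓣 A : Type*} [MeasurableSpace X] [MeasurableSpace 𝓣] [MeasurableSpace A]

/-- Sufficiency of a (possibly randomized) statistic `T ∼ κ(x)`: there is a version `M` of the
conditional law of the data given `T` that does not depend on the parameter. The joint law of
`(T, data)` under `θ` is on the left, and `law of T ⊗ M` on the right. -/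
def IsSufficient (P : Θ → Measure X) (κ : Kernel X 𝓣) : Prop :=
  ∃ M : Kernel 𝓣 X, IsMarkovKernel M ∧
    ∀ θ, (P θ ⊗ₘ κ).map Prod.swap = (κ ∘ₘ P θ) ⊗ₘ M

/-- The procedures that use the data only through the statistic `T ∼ κ(x)`: draw `T`, then choose
an action by a decision rule that sees `T` alone. -/
def proceduresThrough (κ : Kernel X 𝓣) (A : Type*) [MeasurableSpace A] :
    Set (DecisionRule X A) :=
  {δ | ∃ ρ : DecisionRule 𝓣 A, δ.1 = ρ.1 ∘ₖ κ}

end Reduction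

/-! ### Conformal ranks -/

section Rank

/-- The rank vector of the scores `s`: the rank of `s i` is `#{j : s j ≤ s i}`. It carries exactly
the order relations (with ties) between the scores. -/
noncomputable def rankVector {m : ℕ} (s : Fin m → ℝ) : Fin m → ℕ :=
  fun i => ∑ j, if s j ≤ s i then 1 else 0

theorem measurable_rankVector {m : ℕ} : Measurable (rankVector (m := m)) := by
  refine measurable_pi_lambda _ fun i => Finset.measurable_sum _ fun j _ => ?_
  exact Measurable.ite (measurableSet_le (measurable_pi_apply j) (measurable_pi_apply i))
    measurable_const measurable_const

/-- A rank-generated reduction of the data `x`: compute the scores `S x`, take their rank vector,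
and pass it through the Markov kernel `K`. The rank vector itself (`K = Kernel.id`), any function
of the ranks (`K` deterministic) and randomized tie-breaking are special cases. -/
noncomputable def rankReduction {X 𝓣 : Type*} [MeasurableSpace X] [MeasurableSpace 𝓣] {m : ℕ}
    (S : X → Fin m → ℝ) (hS : Measurable S) (K : Kernel (Fin m → ℕ) 𝓣) : Kernel X 𝓣 :=
  K.comap (fun x => rankVector (S x)) (measurable_rankVector.comp hS)

end Rank

end Conformal

open Conformal

/-! Non-sufficiency is first located at two parameters, and there becomes a failure in testing one
law against another. Everything is done for an arbitrary Markov kernel `κ` in place of the rank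
reduction. In a dominated family a statistic sufficient for every pair is sufficient
(`isSufficient_of_pairs`): a countable mixture `lam` of the laws dominates all of them, the
densities with respect to `lam` depend on the statistic alone, and so the conditional law of the
data under `lam` serves every parameter. Hence some pair `μ`, `ν` is bad. For a bad pair, let `h`
and `g` be the densities of `ν` with respect to `μ + ν`, for the data and for the statistic. If for
every weight `s` in `(0, 1)` the tests through `κ` came arbitrarily close to the least weighted
error, then `s < h` and `s < g` would agree almost surely off `h = s`. Rational `s` would give `h =
g`, which is pair sufficiency. So some `s` leaves a gap (`exists_gap_of_not_isPairSufficient`). The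
loss is the testing loss of the pair, the prior has weights `s` and `1 - s`, and the class is that
of the admissible rules, which Neyman–Pearson shows to be complete and Bayes. The dominated
rank-based rule is the most powerful one at the level of the Bayes rule. -/

namespace Conformal

open scoped ENNReal

/-! ### Countable dominating subfamilies and densities with respect to a mixture. -/

section HalmosSavage

/-- **Halmos–Savage**: a dominated family is dominated by countably many of its members. -/
theorem IsDominated.exists_seq {Θ X : Type*} [Nonempty Θ] [MeasurableSpace X]
    {P : Θ → Measure X} [∀ θ, IsProbabilityMeasure (P θ)] (hP : IsDominated P) :
    ∃ u : ℕ → Θ, ∀ θ, P θ ≪ Measure.sum fun i => P (u i) := by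
  obtain ⟨μ₀, _, hμ₀⟩ := hP
  set μ : Measure X := μ₀.toFinite with hμ
  have hPμ : ∀ θ, P θ ≪ μ := fun θ => (hμ₀ θ).trans (absolutelyContinuous_toFinite μ₀)
  set D : Θ → Set X := fun θ => {x | (P θ).rnDeriv μ x ≠ 0} with hD
  have hDm : ∀ θ, MeasurableSet (D θ) := fun θ =>
    (Measure.measurable_rnDeriv _ _) (measurableSet_singleton (0 : ℝ≥0∞)).compl
  have hnull : ∀ θ s, P θ s = 0 ↔ μ (D θ ∩ s) = 0 := fun θ s => by
    rw [← withDensity_apply_eq_zero (Measure.measurable_rnDeriv (P θ) μ),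
      Measure.withDensity_rnDeriv_eq _ _ (hPμ θ)]
  -- Exhaustion: choose countably many supports `D` whose union has the largest possible
  -- `μ`-measure.
  set F : (ℕ → Θ) → ℝ≥0∞ := fun u => μ (⋃ i, D (u i)) with hF
  obtain ⟨a, -, ha, hmem⟩ := exists_seq_tendsto_sSup (Set.range_nonempty F) (OrderTop.bddAbove _)
  choose v hv using hmem
  -- The union over a maximizing sequence of countable families is again countable, so the supremum
  -- is attained.
  set w : ℕ → Θ := fun k => v k.unpair.1 k.unpair.2 with hw
  have hFw : ∀ u, F u ≤ F w := fun u => by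
    refine (le_sSup (Set.mem_range_self u)).trans (le_of_tendsto' ha fun n => ?_)
    rw [← hv n]
    refine measure_mono (Set.iUnion_subset fun i => ?_)
    refine Set.subset_iUnion_of_subset (Nat.pair n i) ?_
    simp [hw]
  refine ⟨w, fun θ => Measure.AbsolutelyContinuous.mk fun s hs h => ?_⟩
  rw [Measure.sum_apply _ hs, ENNReal.tsum_eq_zero] at h
  have h1 : μ ((⋃ i, D (w i)) ∩ s) = 0 := by
    rw [Set.iUnion_inter]
    exact measure_iUnion_null fun i => (hnull _ _).1 (h i)
  have h2 : μ (D θ \ ⋃ i, D (w i)) = 0 := by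
    -- Prepending `θ` to `w` cannot enlarge the union by more than a null set.
    have hle := hFw (fun k => Nat.casesOn k θ w)
    have hsub : (⋃ i, D (w i)) ⊆ ⋃ k, D ((fun k => Nat.casesOn k θ w : ℕ → Θ) k) :=
      Set.iUnion_subset fun i => Set.subset_iUnion_of_subset (i + 1) subset_rfl
    have hae := ae_eq_of_subset_of_measure_ge hsub hle
      (MeasurableSet.iUnion fun i => hDm _).nullMeasurableSet (measure_ne_top _ _)
    refine measure_mono_null ?_ (ae_le_set.1 hae.symm.le)
    exact Set.sdiff_subset_sdiff_left (Set.subset_iUnion_of_subset 0 subset_rfl)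
  rw [hnull]
  refine measure_mono_null (t := ((⋃ i, D (w i)) ∩ s) ∪ (D θ \ ⋃ i, D (w i))) ?_
    (measure_union_null h1 h2)
  rintro x ⟨hx, hxs⟩
  by_cases hxD : x ∈ ⋃ i, D (w i)
  · exact Or.inl ⟨hxD, hxs⟩
  · exact Or.inr ⟨hx, hxD⟩

/-- If the densities of `J` and `ν i` with respect to `ν i + J` are `g i` and `1 - g i`, then the
density of `J` with respect to a mixture of the `ν i` is an explicit function of the `g i`. -/
theorem eq_withDensity_mixture {Z : Type*} [MeasurableSpace Z] {J lam : Measure Z}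
    {ν : ℕ → Measure Z} [IsFiniteMeasure J] [IsFiniteMeasure lam] [∀ i, IsFiniteMeasure (ν i)]
    {c : ℕ → ℝ≥0∞} (hc : ∀ i, c i ≠ 0) (hlam : lam = Measure.sum fun i => c i • ν i)
    (hJ : J ≪ lam) {g : ℕ → Z → ℝ≥0∞} (hg : ∀ i, Measurable (g i))
    (hJg : ∀ i, J = (ν i + J).withDensity (g i))
    (hνg : ∀ i, ν i = (ν i + J).withDensity fun z => 1 - g i z) :
    J = lam.withDensity fun z => (∑' i, c i * ((1 - g i z) / g i z))⁻¹ := by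
  set Λ := lam + J with hΛ
  have hνlam : ∀ i, ν i ≪ lam := fun i => by
    refine Measure.AbsolutelyContinuous.mk fun s hs h => ?_
    rw [hlam, Measure.sum_apply _ hs, ENNReal.tsum_eq_zero] at h
    simpa [hc i] using h i
  have hlamΛ : lam ≪ Λ := Measure.le_add_right le_rfl |>.absolutelyContinuous
  have hJΛ : J ≪ Λ := hJ.trans hlamΛ
  -- With densities `p`, `q i`, `Q` of `J`, `ν i`, `lam` relative to `Λ`, the ratio `(1 - g i) / g
  -- i` is `q i / p` where `p ≠ 0`. The sum is then `Q / p`, and its inverse times `Q` is `p`.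
  set p := J.rnDeriv Λ with hp
  set q := fun i => (ν i).rnDeriv Λ with hq
  have hpm : Measurable p := Measure.measurable_rnDeriv _ _
  have hqm : ∀ i, Measurable (q i) := fun i => Measure.measurable_rnDeriv _ _
  have hJp : Λ.withDensity p = J := Measure.withDensity_rnDeriv_eq _ _ hJΛ
  have hνq : ∀ i, Λ.withDensity (q i) = ν i := fun i =>
    Measure.withDensity_rnDeriv_eq _ _ ((hνlam i).trans hlamΛ)
  have hsum : ∀ i, ν i + J = Λ.withDensity (q i + p) := fun i => by
    rw [withDensity_add_left (hqm i), hJp, hνq]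
  set Q : Z → ℝ≥0∞ := fun z => ∑' i, c i * q i z with hQ
  have hQm : Measurable Q := Measurable.tsum fun i => (hqm i).const_mul _
  have hlamQ : Λ.withDensity Q = lam := by
    have : Q = ∑' i, c i • q i := by
      ext z; rw [tsum_apply (Pi.summable.2 fun _ => ENNReal.summable)]; simp [hQ]
    rw [this, withDensity_tsum fun i => (hqm i).const_smul _, hlam]
    congr 1; ext1 i
    rw [withDensity_smul _ (hqm i), hνq]
  have e1 : ∀ i, p =ᵐ[Λ] (q i + p) * g i := fun i => by
    rw [← withDensity_eq_iff hpm.aemeasurable (((hqm i).add hpm).mul (hg i)).aemeasurable]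
    · rw [withDensity_mul _ ((hqm i).add hpm) (hg i), ← hsum, hJp]; exact hJg i
    · rw [← setLIntegral_univ, ← withDensity_apply _ .univ, hJp]; exact measure_ne_top _ _
  have e2 : ∀ i, q i =ᵐ[Λ] (q i + p) * fun z => 1 - g i z := fun i => by
    have hm : Measurable fun z => 1 - g i z := measurable_const.sub (hg i)
    rw [← withDensity_eq_iff (hqm i).aemeasurable (((hqm i).add hpm).mul hm).aemeasurable]
    · rw [withDensity_mul _ ((hqm i).add hpm) hm, ← hsum, hνq]; exact hνg i
    · rw [← setLIntegral_univ, ← withDensity_apply _ .univ, hνq]; exact measure_ne_top _ _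
  have e3 : Q + p =ᵐ[Λ] fun _ => 1 := by
    rw [← withDensity_eq_iff (hQm.add hpm).aemeasurable aemeasurable_const]
    · rw [withDensity_add_left hQm, hlamQ, hJp, withDensity_const, one_smul]
    · rw [← setLIntegral_univ, ← withDensity_apply _ .univ, withDensity_add_left hQm, hlamQ, hJp]
      exact measure_ne_top _ _
  have e4 : ∀ᵐ z ∂Λ, Q z = 0 → p z = 0 := by
    have h0 : lam {z | Q z = 0} = 0 := by
      rw [← hlamQ, withDensity_apply_eq_zero hQm]
      convert measure_empty (μ := Λ)
      ext z; simp
    have := hJ h0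
    rw [← hJp, withDensity_apply_eq_zero hpm, measure_eq_zero_iff_ae_notMem] at this
    filter_upwards [this] with z hz h
    by_contra h'
    exact hz ⟨h', h⟩
  have hgm : Measurable fun z => (∑' i, c i * ((1 - g i z) / g i z))⁻¹ :=
    (Measurable.tsum fun i =>
      ((measurable_const.sub (hg i)).div (hg i)).const_mul _).inv
  conv_lhs => rw [← hJp]
  rw [← hlamQ, ← withDensity_mul _ hQm hgm]
  refine withDensity_congr_ae ?_
  filter_upwards [ae_all_iff.2 e1, ae_all_iff.2 e2, e3, e4] with z h1 h2 h3 h4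
  simp only [Pi.mul_apply, Pi.add_apply] at h1 h2 h3 ⊢
  have hpt : p z ≠ ∞ := fun h => by simp [h] at h3
  have hQt : Q z ≠ ∞ := fun h => by simp [h] at h3
  by_cases hp0 : p z = 0
  -- Where `p = 0` some `q i` is nonzero and forces `g i = 0`; the term `1 / 0 = ∞` makes the
  -- inverse of the sum vanish, as required.
  · have hQ1 : Q z ≠ 0 := fun h => by simp [h, hp0] at h3
    obtain ⟨i, hi⟩ : ∃ i, c i * q i z ≠ 0 := by
      by_contra! h
      exact hQ1 (by simp [hQ, h])
    have hqi : q i z ≠ 0 := fun h => hi (by simp [h])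
    have hgi : g i z = 0 := by
      have := h1 i
      rw [hp0, add_zero, eq_comm, mul_eq_zero] at this
      exact this.resolve_left hqi
    have : (∑' i, c i * ((1 - g i z) / g i z)) = ∞ := by
      refine ENNReal.tsum_eq_top_of_eq_top ⟨i, ?_⟩
      rw [hgi, tsub_zero, ENNReal.div_zero one_ne_zero, ENNReal.mul_top (hc i)]
    rw [this, hp0]; simp
  · have hQ0 : Q z ≠ 0 := fun h => hp0 (h4 h)
    have key : ∀ i, (1 - g i z) / g i z = q i z / p z := fun i => by
      have hS0 : q i z + p z ≠ 0 := fun h => hp0 (add_eq_zero.1 h).2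
      by_cases hSt : q i z + p z = ∞
      · have := h1 i
        rw [hSt] at this
        have hg0 : g i z ≠ 0 := fun h => hp0 (by rw [this, h, mul_zero])
        rw [ENNReal.top_mul hg0] at this
        exact absurd this hpt
      · calc (1 - g i z) / g i z
            = (q i z + p z) * (1 - g i z) / ((q i z + p z) * g i z) :=
              (ENNReal.mul_div_mul_left _ _ hS0 hSt).symm
          _ = q i z / p z := by rw [← h1 i, ← h2 i]
    have : (∑' i, c i * ((1 - g i z) / g i z)) = Q z / p z := by
      simp only [key, hQ, div_eq_mul_inv, ← ENNReal.tsum_mul_right, mul_assoc]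
    rw [this, ENNReal.inv_div (Or.inl hpt) (Or.inl hp0), ENNReal.mul_div_cancel hQ0 hQt]

end HalmosSavage

/-! ### From pairwise sufficiency to sufficiency. -/

section Sufficiency

variable {Θ X 𝓣 : Type*} [MeasurableSpace X] [MeasurableSpace 𝓣]

theorem withDensity_compProd {μ : Measure X} [SFinite μ] {f : X → ℝ≥0∞} (hf : Measurable f)
    [SFinite (μ.withDensity f)] (κ : Kernel X 𝓣) [IsSFiniteKernel κ] :
    μ.withDensity f ⊗ₘ κ = (μ ⊗ₘ κ).withDensity fun z => f z.1 := by
  ext s hs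
  rw [Measure.compProd_apply hs, withDensity_apply _ hs, ← lintegral_indicator hs,
    Measure.lintegral_compProd (f := s.indicator fun z => f z.1)
      ((hf.comp measurable_fst).indicator hs),
    lintegral_withDensity_eq_lintegral_mul _ hf (Kernel.measurable_kernel_prodMk_left hs)]
  refine lintegral_congr fun x => ?_
  have : (fun t => s.indicator (fun z : X × 𝓣 => f z.1) (x, t)) =
      (Prod.mk x ⁻¹' s).indicator fun _ => f x := by ext t; rfl
  rw [this, lintegral_indicator_const (measurable_prodMk_left hs), Pi.mul_apply]

/-- The likelihood ratios of `μ` and `ν` are functions of the statistic drawn from `κ`: the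
densities of their joint laws with respect to the sum depend on the statistic only. -/
def IsPairSufficient (μ ν : Measure X) (κ : Kernel X 𝓣) : Prop :=
  ∃ g : 𝓣 → ℝ≥0∞, Measurable g ∧
    ν ⊗ₘ κ = (μ ⊗ₘ κ + ν ⊗ₘ κ).withDensity (fun z => g z.2) ∧
    μ ⊗ₘ κ = (μ ⊗ₘ κ + ν ⊗ₘ κ).withDensity (fun z => 1 - g z.2)

/-- In a dominated family, pairwise sufficiency implies sufficiency. -/
theorem isSufficient_of_pairs [Nonempty Θ] [StandardBorelSpace X] {P : Θ → Measure X}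
    [∀ θ, IsProbabilityMeasure (P θ)] (hP : IsDominated P) (κ : Kernel X 𝓣) [IsMarkovKernel κ]
    (h : ∀ θ₁ θ₂, IsPairSufficient (P θ₁) (P θ₂) κ) : IsSufficient P κ := by
  obtain ⟨u, hu⟩ := hP.exists_seq
  have : Nonempty X := (P (u 0)).nonempty_of_neZero
  set c : ℕ → ℝ≥0∞ := fun i => 2⁻¹ ^ (i + 1) with hcdef
  have hc : ∀ i, c i ≠ 0 := fun i => by simp [hcdef]
  set lam : Measure X := Measure.sum fun i => c i • P (u i) with hlam
  have : IsFiniteMeasure lam := ⟨by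
    rw [hlam, Measure.sum_apply _ .univ]
    simp [hcdef, ENNReal.tsum_geometric_add_one,
      ENNReal.inv_mul_cancel two_ne_zero ENNReal.ofNat_ne_top]⟩
  have hlamP : ∀ θ, P θ ≪ lam := fun θ => by
    refine (hu θ).trans (Measure.AbsolutelyContinuous.mk fun s hs h => ?_)
    rw [hlam, Measure.sum_apply _ hs, ENNReal.tsum_eq_zero] at h
    rw [Measure.sum_apply _ hs, ENNReal.tsum_eq_zero]
    exact fun i => by simpa [hc i] using h i
  have hJ : lam ⊗ₘ κ = Measure.sum fun i => c i • (P (u i) ⊗ₘ κ) := by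
    simp only [← Measure.compProd_smul_left]
    exact Measure.compProd_sum_left
  set ρ : Measure (𝓣 × X) := (lam ⊗ₘ κ).map Prod.swap with hρ
  have : IsFiniteMeasure ρ := Measure.isFiniteMeasure_map _ _
  -- The common conditional law is the one under the mixture: the density `G` depends on the
  -- statistic only, so reweighting `ρ` by `G` changes its marginal and not its conditional kernel.
  refine ⟨ρ.condKernel, inferInstance, fun θ => ?_⟩
  choose g hgm hg1 hg2 using fun i => h (u i) θ
  set G : 𝓣 → ℝ≥0∞ := fun t => (∑' i, c i * ((1 - g i t) / g i t))⁻¹ with hG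
  have hGm : Measurable G := (Measurable.tsum fun i =>
      ((measurable_const.sub (hgm i)).div (hgm i)).const_mul _).inv
  have hdens : P θ ⊗ₘ κ = (lam ⊗ₘ κ).withDensity fun z => G z.2 :=
    eq_withDensity_mixture hc hJ ((hlamP θ).compProd_left κ)
      (fun i => (hgm i).comp measurable_snd) hg1 hg2
  have hswap : (P θ ⊗ₘ κ).map Prod.swap = ρ.withDensity fun z => G z.1 := by
    rw [hdens]
    ext s hs
    rw [Measure.map_apply measurable_swap hs, withDensity_apply _ (measurable_swap hs),
      withDensity_apply _ hs, hρ, setLIntegral_map hs (f := fun z => G z.1)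
        (by fun_prop) measurable_swap]
    rfl
  have hfin : IsFiniteMeasure (ρ.fst.withDensity G) := by
    refine isFiniteMeasure_withDensity (ne_of_lt ?_)
    have : ∫⁻ t, G t ∂ρ.fst = ((P θ ⊗ₘ κ).map Prod.swap) Set.univ := by
      rw [hswap, withDensity_apply _ .univ, setLIntegral_univ, Measure.fst,
        lintegral_map hGm measurable_fst]
    rw [this, Measure.map_apply measurable_swap .univ]
    exact measure_lt_top _ _
  have hprod : ρ.withDensity (fun z => G z.1) = ρ.fst.withDensity G ⊗ₘ ρ.condKernel := by
    rw [withDensity_compProd hGm, Measure.disintegrate]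
  have hfst : κ ∘ₘ P θ = ρ.fst.withDensity G := by
    rw [← Measure.snd_compProd, ← Measure.fst_map_swap, hswap, hprod, Measure.fst_compProd]
  rw [hswap, hprod, hfst]

end Sufficiency

/-! ### Tests of two laws, likelihoods and weighted errors. -/

section Testing

variable {X 𝓣 : Type*} [MeasurableSpace X] [MeasurableSpace 𝓣]

/-- The probability that the rule `δ` takes action `1` when it observes `x`. -/
noncomputable def power (δ : DecisionRule X (Fin 2)) (x : X) : ℝ := (δ.1 x).real {1}

theorem measurable_power (δ : DecisionRule X (Fin 2)) : Measurable (power δ) :=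
  (δ.1.measurable_coe (measurableSet_singleton 1)).ennreal_toReal

theorem power_mem (δ : DecisionRule X (Fin 2)) (x : X) : power δ x ∈ Set.Icc (0 : ℝ) 1 :=
  have := δ.2
  ⟨measureReal_nonneg, measureReal_le_one⟩

theorem exists_rule {φ : X → ℝ} (hφ : Measurable φ) (h01 : ∀ x, φ x ∈ Set.Icc (0 : ℝ) 1) :
    ∃ δ : DecisionRule X (Fin 2), power δ = φ := by
  let κ : Kernel X (Fin 2) :=
    { toFun := fun x => ENNReal.ofReal (φ x) • Measure.dirac 1 +
        ENNReal.ofReal (1 - φ x) • Measure.dirac 0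
      measurable' := by
        refine Measure.measurable_of_measurable_coe _ fun s _ => ?_
        simp only [Measure.add_apply, Measure.smul_apply, smul_eq_mul]
        exact (hφ.ennreal_ofReal.mul_const _).add
          ((measurable_const.sub hφ).ennreal_ofReal.mul_const _) }
  have hκ : ∀ x, κ x = ENNReal.ofReal (φ x) • Measure.dirac 1 +
      ENNReal.ofReal (1 - φ x) • Measure.dirac 0 := fun _ => rfl
  refine ⟨⟨κ, ⟨fun x => ⟨?_⟩⟩⟩, funext fun x => ?_⟩
  · simp [hκ, ← ENNReal.ofReal_add (h01 x).1 (sub_nonneg.2 (h01 x).2)]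
  · simp [power, hκ, Measure.real, (h01 x).1]

/-- The probability that the rule `δ` takes action `1` when the data have law `μ`. -/
noncomputable def rejProb (μ : Measure X) (δ : DecisionRule X (Fin 2)) : ℝ := ∫ x, power δ x ∂μ

theorem integrable_power (μ : Measure X) [IsFiniteMeasure μ] (δ : DecisionRule X (Fin 2)) :
    Integrable (power δ) μ :=
  .of_mem_Icc 0 1 (measurable_power δ).aemeasurable (.of_forall (power_mem δ))

theorem rejProb_mem (μ : Measure X) [IsProbabilityMeasure μ] (δ : DecisionRule X (Fin 2)) :
    rejProb μ δ ∈ Set.Icc (0 : ℝ) 1 := by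
  refine ⟨integral_nonneg fun x => (power_mem δ x).1, ?_⟩
  calc rejProb μ δ ≤ ∫ _, (1 : ℝ) ∂μ :=
        integral_mono (integrable_power μ δ) (integrable_const _) fun x => (power_mem δ x).2
    _ = 1 := by simp

theorem rejProb_eq_comp (μ : Measure X) (δ : DecisionRule X (Fin 2)) :
    rejProb μ δ = (δ.1 ∘ₘ μ).real {1} := by
  have := δ.2
  rw [Measure.real, Measure.bind_apply (measurableSet_singleton 1) δ.1.aemeasurable, rejProb,
    ← integral_toReal (δ.1.measurable_coe (measurableSet_singleton 1)).aemeasurable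
      (.of_forall fun x => measure_lt_top _ _)]
  rfl

/-- Testing through `κ` is the testing problem for the pushed-forward laws, so results for full-data
tests also apply to tests through `κ`. -/
theorem rejProb_of_eq_comp (μ : Measure X) {κ : Kernel X 𝓣} {δ : DecisionRule X (Fin 2)}
    {σ : DecisionRule 𝓣 (Fin 2)} (h : δ.1 = σ.1 ∘ₖ κ) :
    rejProb μ δ = rejProb (κ ∘ₘ μ) σ := by
  rw [rejProb_eq_comp, rejProb_eq_comp, h, Measure.comp_assoc]

/-- Mixing a rule with the rule that always takes action `1`. -/
theorem exists_mix (δ : DecisionRule X (Fin 2)) {c : ℝ} (hc : c ∈ Set.Icc (0 : ℝ) 1) :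
    ∃ δ' : DecisionRule X (Fin 2), ∀ (μ : Measure X) [IsProbabilityMeasure μ],
      rejProb μ δ' = c * rejProb μ δ + (1 - c) := by
  obtain ⟨δ', hδ'⟩ := exists_rule (φ := fun x => c * power δ x + (1 - c))
    (((measurable_power δ).const_mul c).add_const _) fun x => by
      have := power_mem δ x
      constructor
      · nlinarith [this.1, this.2, hc.1, hc.2]
      · nlinarith [this.1, this.2, hc.1, hc.2]
  refine ⟨δ', fun μ _ => ?_⟩
  rw [rejProb, hδ', integral_add ((integrable_power μ δ).const_mul c) (integrable_const _),
    integral_const_mul]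
  simp [rejProb]

/-- A rule of maximal power at its level that is not of full power is not dominated. -/
theorem not_better_of_maximal {μ ν : Measure X} [IsProbabilityMeasure μ] [IsProbabilityMeasure ν]
    {σ : DecisionRule X (Fin 2)} (hσ : ∀ τ, rejProb μ τ = rejProb μ σ → rejProb ν τ ≤ rejProb ν σ)
    (h1 : rejProb ν σ < 1) (τ : DecisionRule X (Fin 2)) :
    ¬ ((rejProb μ τ ≤ rejProb μ σ ∧ rejProb ν σ ≤ rejProb ν τ) ∧
      (rejProb μ τ < rejProb μ σ ∨ rejProb ν σ < rejProb ν τ)) := by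
  rintro ⟨⟨ha, hb⟩, hlt⟩
  rcases ha.eq_or_lt with ha | ha
  · rcases hlt with h | h
    · exact h.ne ha
    · exact (hσ τ ha).not_gt h
  · have hσ1 := (rejProb_mem μ σ).2
    have hτ1 : rejProb μ τ < 1 := ha.trans_le hσ1
    -- `c` is chosen so that mixing `τ` with the constant action `1` has exactly the level of `σ`.
    -- Since `rejProb ν σ < 1`, the mixture would have more power than `σ`.
    set c := (1 - rejProb μ σ) / (1 - rejProb μ τ) with hc
    have hc0 : 0 ≤ c := div_nonneg (by linarith) (by linarith)
    have hc1 : c < 1 := (div_lt_one (by linarith)).2 (by linarith)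
    have hcm : c * (1 - rejProb μ τ) = 1 - rejProb μ σ := div_mul_cancel₀ _ (by linarith)
    obtain ⟨δ, hδ⟩ := exists_mix τ ⟨hc0, hc1.le⟩
    have h := hσ δ (by rw [hδ]; linarith)
    rw [hδ] at h
    nlinarith [(rejProb_mem ν τ).2]

/-- `h` and `1 - h` are densities of `ν` and `μ` with respect to `μ + ν`. -/
structure IsLikelihood (μ ν : Measure X) (h : X → ℝ) : Prop where
  measurable : Measurable h
  mem : ∀ x, h x ∈ Set.Icc (0 : ℝ) 1
  left : μ = (μ + ν).withDensity fun x => ENNReal.ofReal (1 - h x)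
  right : ν = (μ + ν).withDensity fun x => ENNReal.ofReal (h x)

theorem exists_isLikelihood (μ ν : Measure X) [IsFiniteMeasure μ] [IsFiniteMeasure ν] :
    ∃ h, IsLikelihood μ ν h := by
  have hle : ν ≤ μ + ν := Measure.le_add_left le_rfl
  -- Truncation at `1` makes the bounds hold at every point, not just almost everywhere.
  set h : X → ℝ := fun x => (min (ν.rnDeriv (μ + ν) x) 1).toReal with hh
  have hm : Measurable h :=
    ((Measure.measurable_rnDeriv _ _).min measurable_const).ennreal_toReal
  have hmem : ∀ x, h x ∈ Set.Icc (0 : ℝ) 1 := fun x =>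
    ⟨ENNReal.toReal_nonneg, ENNReal.toReal_mono ENNReal.one_ne_top (min_le_right _ _)⟩
  have hr : ν = (μ + ν).withDensity fun x => ENNReal.ofReal (h x) := by
    conv_lhs => rw [← Measure.withDensity_rnDeriv_eq _ _ hle.absolutelyContinuous]
    refine withDensity_congr_ae ?_
    filter_upwards [Measure.rnDeriv_le_one_of_le hle] with x hx
    rw [hh, ENNReal.ofReal_toReal (by simp), min_eq_left (by simpa using hx)]
  refine ⟨h, hm, hmem, ?_, hr⟩
  have hsum : (μ + ν).withDensity (fun x => ENNReal.ofReal (1 - h x)) + ν = μ + ν := by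
    conv_lhs => enter [2]; rw [hr]
    rw [← withDensity_add_left (by fun_prop)]
    conv_rhs => rw [← withDensity_one (μ := μ + ν)]
    congr 1
    ext x
    simp [← ENNReal.ofReal_add (sub_nonneg.2 (hmem x).2) (hmem x).1]
  ext s _
  have := congrArg (fun m => m s) hsum
  simp only [Measure.add_apply] at this
  exact ((ENNReal.add_left_inj (measure_ne_top ν s)).1 this).symm

namespace IsLikelihood

variable {μ ν : Measure X} {h : X → ℝ}

theorem measurable_ofReal_one_sub (H : IsLikelihood μ ν h) :
    Measurable fun x => ENNReal.ofReal (1 - h x) := by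
  have := H.measurable
  fun_prop

theorem integral_right (H : IsLikelihood μ ν h) (φ : X → ℝ) :
    ∫ x, φ x ∂ν = ∫ x, φ x * h x ∂(μ + ν) := by
  conv_lhs => rw [H.right]
  rw [integral_withDensity_eq_integral_toReal_smul H.measurable.ennreal_ofReal (by simp)]
  exact integral_congr_ae (.of_forall fun x => by
    simp [ENNReal.toReal_ofReal (H.mem x).1, mul_comm])

theorem integral_left (H : IsLikelihood μ ν h) (φ : X → ℝ) :
    ∫ x, φ x ∂μ = ∫ x, φ x * (1 - h x) ∂(μ + ν) := by
  conv_lhs => rw [H.left]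
  rw [integral_withDensity_eq_integral_toReal_smul
    H.measurable_ofReal_one_sub (by simp)]
  exact integral_congr_ae (.of_forall fun x => by
    simp [ENNReal.toReal_ofReal (sub_nonneg.2 (H.mem x).2), mul_comm])

theorem integrable_mul [IsFiniteMeasure μ] [IsFiniteMeasure ν] (H : IsLikelihood μ ν h)
    (δ : DecisionRule X (Fin 2)) (a b : ℝ) :
    Integrable (fun x => power δ x * (a - b * h x)) (μ + ν) := by
  have hh : Integrable h (μ + ν) :=
    .of_mem_Icc 0 1 H.measurable.aemeasurable (.of_forall H.mem)
  refine Integrable.bdd_mul (c := 1) ((integrable_const a).sub (hh.const_mul b))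
    (measurable_power δ).aestronglyMeasurable (.of_forall fun x => ?_)
  rw [Real.norm_eq_abs, abs_of_nonneg (power_mem δ x).1]
  exact (power_mem δ x).2

end IsLikelihood

/-- The average error probability of the test `δ` of `μ` against `ν`, for the weights `s` and
`1 - s`. -/
noncomputable def weightedError (μ ν : Measure X) (s : ℝ) (δ : DecisionRule X (Fin 2)) : ℝ :=
  s * rejProb μ δ + (1 - s) * (1 - rejProb ν δ)

/-- Since `s * (1 - h) - (1 - s) * h = s - h`, the error can be minimized pointwise: action `1`
where `s < h`, action `0` where `h < s`. -/
theorem weightedError_eq {μ ν : Measure X} [IsFiniteMeasure μ] [IsFiniteMeasure ν] {h : X → ℝ}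
    (H : IsLikelihood μ ν h) (s : ℝ) (δ : DecisionRule X (Fin 2)) :
    weightedError μ ν s δ = (1 - s) + ∫ x, power δ x * (s - h x) ∂(μ + ν) := by
  rw [weightedError, rejProb, rejProb, H.integral_left, H.integral_right]
  have i1 := H.integrable_mul δ 1 1
  have i2 := H.integrable_mul δ 0 (-1)
  simp only [one_mul, neg_mul, sub_neg_eq_add, zero_add] at i1 i2
  have : ∀ x, power δ x * (s - h x) =
      s * (power δ x * (1 - h x)) - (1 - s) * (power δ x * h x) := fun x => by ring
  simp_rw [this]
  rw [integral_sub (i1.const_mul s) (i2.const_mul (1 - s)), integral_const_mul,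
    integral_const_mul]
  ring

theorem min_le_power_mul (δ : DecisionRule X (Fin 2)) (x : X) (y : ℝ) :
    min y 0 ≤ power δ x * y := by
  obtain ⟨h0, h1⟩ := power_mem δ x
  rcases le_total y 0 with hy | hy
  · rw [min_eq_left hy]; nlinarith
  · rw [min_eq_right hy]; positivity

/-- The likelihood ratio tests are Bayes. -/
theorem weightedError_le_of_power_mul {μ ν : Measure X} [IsFiniteMeasure μ] [IsFiniteMeasure ν]
    {h : X → ℝ} (H : IsLikelihood μ ν h) {s : ℝ} {δ : DecisionRule X (Fin 2)}
    (hδ : ∀ x, power δ x * (s - h x) = min (s - h x) 0) (δ' : DecisionRule X (Fin 2)) :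
    weightedError μ ν s δ ≤ weightedError μ ν s δ' := by
  have i := fun δ => by simpa only [one_mul] using H.integrable_mul δ s 1
  rw [weightedError_eq H, weightedError_eq H]
  exact add_le_add_right (integral_mono (i δ) (i δ') fun x => by
    simpa only [hδ x] using min_le_power_mul δ' x _) _

/-- Equal integrals of ordered integrands force equality almost everywhere, so the optimal test is
unique off `h = s`. -/
theorem power_mul_ae_eq_of_weightedError_le {μ ν : Measure X} [IsFiniteMeasure μ]
    [IsFiniteMeasure ν] {h : X → ℝ} (H : IsLikelihood μ ν h) {s : ℝ}
    {δ δ' : DecisionRule X (Fin 2)} (hδ : ∀ x, power δ x * (s - h x) = min (s - h x) 0)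
    (hle : weightedError μ ν s δ' ≤ weightedError μ ν s δ) :
    ∀ᵐ x ∂(μ + ν), power δ' x * (s - h x) = min (s - h x) 0 := by
  have i := fun δ => by simpa only [one_mul] using H.integrable_mul δ s 1
  rw [weightedError_eq H, weightedError_eq H, add_le_add_iff_left] at hle
  have hmono : ∀ x, power δ x * (s - h x) ≤ power δ' x * (s - h x) := fun x => by
    simpa only [hδ x] using min_le_power_mul δ' x _
  have := (integral_eq_iff_of_ae_le (i δ) (i δ') (.of_forall hmono)).1
    (le_antisymm (integral_mono (i δ) (i δ') hmono) hle)
  filter_upwards [this] with x hx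
  rw [← hx, hδ x]

theorem exists_threshold_rule {h : X → ℝ} (hm : Measurable h) (s : ℝ) :
    ∃ δ : DecisionRule X (Fin 2), power δ = ({x | s < h x}.indicator 1) ∧
      ∀ x, power δ x * (s - h x) = min (s - h x) 0 := by
  obtain ⟨δ, hδ⟩ := exists_rule (φ := {x | s < h x}.indicator 1)
    (measurable_one.indicator (measurableSet_lt measurable_const hm)) fun x => by
      by_cases hx : s < h x <;> simp [hx]
  refine ⟨δ, hδ, fun x => ?_⟩
  rw [hδ]
  by_cases hx : s < h x
  · simp [hx, hx.le]
  · simp [hx, not_lt.1 hx]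

end Testing

/-! ### Most powerful tests, and the gap left by an insufficient statistic. -/

section NeymanPearson

variable {X 𝓣 : Type*} [MeasurableSpace X] [MeasurableSpace 𝓣]

/-- The threshold is a `1 - α` quantile of `h` under `μ`, by continuity of the measure from below
and from above. The two inequalities leave room for randomization on `h = s`. -/
theorem exists_quantile {μ : Measure X} [IsProbabilityMeasure μ] {h : X → ℝ} (hm : Measurable h)
    (h01 : ∀ x, h x ∈ Set.Icc (0 : ℝ) 1) {α : ℝ} (hα : α ∈ Set.Icc (0 : ℝ) 1) :
    ∃ s ∈ Set.Icc (0 : ℝ) 1, μ.real {x | s < h x} ≤ α ∧ α ≤ μ.real {x | s ≤ h x} := by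
  set A : Set ℝ := {s | s ∈ Set.Icc (0 : ℝ) 1 ∧ μ.real {x | s < h x} ≤ α} with hA
  have h1 : (1 : ℝ) ∈ A := by
    refine ⟨by simp, ?_⟩
    have : {x | 1 < h x} = ∅ := by ext x; simpa using (h01 x).2
    simpa [this] using hα.1
  have hbdd : BddBelow A := ⟨0, fun s hs => hs.1.1⟩
  set s := sInf A with hs
  have hs0 : 0 ≤ s := le_csInf ⟨1, h1⟩ fun a ha => ha.1.1
  refine ⟨s, ⟨hs0, csInf_le hbdd h1⟩, ?_, ?_⟩
  · have hU : {x | s < h x} = ⋃ n : ℕ, {x | s + 1 / (n + 1 : ℝ) < h x} := by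
      ext x
      simp only [Set.mem_ofPred_eq, Set.mem_iUnion]
      constructor
      · intro hx
        obtain ⟨n, hn⟩ := exists_nat_one_div_lt (sub_pos.2 hx)
        exact ⟨n, by linarith⟩
      · rintro ⟨n, hn⟩
        have : (0 : ℝ) < 1 / (n + 1 : ℝ) := Nat.one_div_pos_of_nat
        linarith
    refine ENNReal.toReal_le_of_le_ofReal hα.1 ?_
    rw [hU, Monotone.measure_iUnion]
    · refine iSup_le fun n => ?_
      have hn : (0 : ℝ) < 1 / (n + 1 : ℝ) := Nat.one_div_pos_of_nat
      obtain ⟨a, ha, hlt⟩ := exists_lt_of_csInf_lt ⟨1, h1⟩ (lt_add_of_pos_right s hn)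
      refine (measure_mono fun x hx => ?_).trans
        ((ENNReal.le_ofReal_iff_toReal_le (measure_ne_top _ _) hα.1).2 ha.2)
      exact hlt.trans hx
    · intro n k hnk x hx
      exact (add_le_add_right (Nat.one_div_le_one_div hnk) s).trans_lt hx
  · have hI : {x | s ≤ h x} = ⋂ n : ℕ, {x | s - 1 / (n + 1 : ℝ) < h x} := by
      ext x
      simp only [Set.mem_ofPred_eq, Set.mem_iInter]
      constructor
      · intro hx n
        have : (0 : ℝ) < 1 / (n + 1 : ℝ) := Nat.one_div_pos_of_nat
        linarith
      · intro hx
        by_contra! hlt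
        obtain ⟨n, hn⟩ := exists_nat_one_div_lt (sub_pos.2 hlt)
        linarith [hx n]
    refine (ENNReal.ofReal_le_iff_le_toReal (measure_ne_top _ _)).1 ?_
    rw [hI, Antitone.measure_iInter]
    · refine le_iInf fun n => (ENNReal.ofReal_le_iff_le_toReal (measure_ne_top _ _)).2 ?_
      have hn : (0 : ℝ) < 1 / (n + 1 : ℝ) := Nat.one_div_pos_of_nat
      by_cases hv : s - 1 / (n + 1 : ℝ) < 0
      · have : {x | s - 1 / (n + 1 : ℝ) < h x} = Set.univ :=
          Set.eq_univ_of_forall fun x => hv.trans_le (h01 x).1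
        rw [this, measure_univ, ENNReal.toReal_one]
        exact hα.2
      · by_contra! hlt
        have := csInf_le hbdd (show s - 1 / (n + 1 : ℝ) ∈ A from
          ⟨⟨not_lt.1 hv, by linarith [csInf_le hbdd h1]⟩, hlt.le⟩)
        linarith
    · intro n k hnk x hx
      exact (sub_le_sub_left (Nat.one_div_le_one_div hnk) s).trans_lt hx
    · exact fun n => (measurableSet_lt measurable_const hm).nullMeasurableSet
    · exact ⟨0, measure_ne_top _ _⟩

/-- **Neyman–Pearson**: at each level there is a most powerful test, and it is Bayes. -/
theorem exists_most_powerful (μ ν : Measure X) [IsProbabilityMeasure μ] [IsProbabilityMeasure ν]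
    {α : ℝ} (hα : α ∈ Set.Icc (0 : ℝ) 1) :
    ∃ δ : DecisionRule X (Fin 2), rejProb μ δ = α ∧
      (∀ δ', rejProb μ δ' = α → rejProb ν δ' ≤ rejProb ν δ) ∧
      ∃ s ∈ Set.Icc (0 : ℝ) 1, ∀ δ', weightedError μ ν s δ ≤ weightedError μ ν s δ' := by
  obtain ⟨h, H⟩ := exists_isLikelihood μ ν
  have hm := H.measurable
  -- Level `0` is separate: the weight is then `s = 1`, which ignores power, so maximality is
  -- checked directly for the test of `h = 1`, where the density of `μ` vanishes.
  rcases hα.1.eq_or_lt with rfl | hpos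
  · obtain ⟨δ, hδ⟩ := exists_rule (φ := {x | 1 ≤ h x}.indicator 1)
      (measurable_one.indicator (measurableSet_le measurable_const hm)) fun x => by
        by_cases hx : 1 ≤ h x <;> simp [hx]
    have hδ0 : ∀ x, power δ x * (1 - h x) = 0 := fun x => by
      rw [hδ]
      by_cases hx : 1 ≤ h x
      · simp [le_antisymm (H.mem x).2 hx]
      · simp [hx]
    refine ⟨δ, ?_, fun δ' h0 => ?_, 1, by simp, weightedError_le_of_power_mul H fun x => ?_⟩
    · rw [rejProb, H.integral_left]
      simp [hδ0]
    · have i := by simpa only [one_mul] using H.integrable_mul δ' 1 1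
      rw [rejProb, H.integral_left, integral_eq_zero_iff_of_nonneg
        (fun x => mul_nonneg (power_mem δ' x).1 (sub_nonneg.2 (H.mem x).2)) i] at h0
      rw [rejProb, rejProb, H.integral_right, H.integral_right (power δ)]
      have j := fun δ => by
        simpa only [neg_mul, one_mul, sub_neg_eq_add, zero_add] using H.integrable_mul δ 0 (-1)
      refine integral_mono_ae (j δ') (j δ) ?_
      filter_upwards [h0] with x hx
      rw [hδ]
      by_cases h1 : 1 ≤ h x
      · simpa [h1] using mul_le_mul_of_nonneg_right (power_mem δ' x).2 (H.mem x).1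
      · have : power δ' x = 0 := by
          rcases mul_eq_zero.1 hx with h | h
          · exact h
          · exact absurd (by linarith) h1
        simp [this, h1]
    · rw [hδ0, min_eq_right (sub_nonneg.2 (H.mem x).2)]
  · obtain ⟨s, hs, hle, hge⟩ := exists_quantile (μ := μ) hm H.mem hα
    -- Needed to cancel `1 - s` at the end; `μ` gives no mass to `h = 1`, which excludes `s = 1` at
    -- a positive level.
    have hs1 : s < 1 := by
      refine hs.2.lt_of_ne fun h1 => hpos.not_ge (hge.trans ?_)
      have hms : MeasurableSet {x | s ≤ h x} := measurableSet_le measurable_const hm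
      rw [← integral_indicator_one hms, H.integral_left]
      refine (integral_eq_zero_of_ae (.of_forall fun x => ?_)).le
      by_cases hx : s ≤ h x
      · simp [le_antisymm (H.mem x).2 (h1 ▸ hx)]
      · simp [hx]
    have hmlt : MeasurableSet {x | s < h x} := measurableSet_lt measurable_const hm
    have hmeq : MeasurableSet {x | h x = s} := measurableSet_eq_fun hm measurable_const
    have hadd : μ.real {x | s ≤ h x} = μ.real {x | s < h x} + μ.real {x | h x = s} := by
      rw [← measureReal_union _ hmeq]
      · congr 1; ext x; simp [le_iff_lt_or_eq, eq_comm]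
      · exact Set.disjoint_left.2 fun x (hx : s < h x) (hx' : h x = s) => hx.ne' hx'
    -- Randomization on `h = s` brings the level to exactly `α`. If that set is null, division by
    -- zero gives `γ = 0` and no correction is needed.
    set γ := (α - μ.real {x | s < h x}) / μ.real {x | h x = s} with hγ
    have hγ0 : 0 ≤ γ := div_nonneg (by linarith) measureReal_nonneg
    have hγ1 : γ ≤ 1 := div_le_one_of_le₀ (by linarith) measureReal_nonneg
    have hγm : γ * μ.real {x | h x = s} = α - μ.real {x | s < h x} := by
      by_cases h0 : μ.real {x | h x = s} = 0
      · rw [h0]; linarith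
      · exact div_mul_cancel₀ _ h0
    obtain ⟨δ, hδ⟩ := exists_rule
      (φ := fun x => {x | s < h x}.indicator 1 x + γ * {x | h x = s}.indicator 1 x)
      ((measurable_one.indicator hmlt).add ((measurable_one.indicator hmeq).const_mul γ))
      fun x => by
        rcases lt_trichotomy s (h x) with hx | hx | hx
        · simp [hx, hx.ne']
        · simp [hx, hγ0, hγ1]
        · simp [hx.not_gt, hx.ne]
    have hδα : rejProb μ δ = α := by
      rw [rejProb, hδ, integral_add, integral_const_mul, integral_indicator_one hmlt,
        integral_indicator_one hmeq, hγm]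
      · ring
      · exact (integrable_const (1 : ℝ)).indicator hmlt
      · exact ((integrable_const (1 : ℝ)).indicator hmeq).const_mul γ
    have hB := weightedError_le_of_power_mul H (s := s) (δ := δ) fun x => by
      rw [hδ]
      rcases lt_trichotomy s (h x) with hx | hx | hx
      · simp [hx, hx.ne', hx.le]
      · simp [hx]
      · simp [hx.not_gt, hx.ne, hx.le]
    refine ⟨δ, hδα, fun δ' h' => ?_, s, hs, hB⟩
    have := hB δ'
    rw [weightedError, weightedError, hδα, h', add_le_add_iff_left] at this
    linarith [le_of_mul_le_mul_left this (sub_pos.2 hs1)]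

/-- Among the rules of full power there is one of least level. -/
theorem exists_full_power (μ ν : Measure X) [IsProbabilityMeasure μ] [IsProbabilityMeasure ν] :
    ∃ δ : DecisionRule X (Fin 2), rejProb ν δ = 1 ∧
      ∀ τ, rejProb ν τ = 1 → rejProb μ δ ≤ rejProb μ τ := by
  obtain ⟨h, H⟩ := exists_isLikelihood μ ν
  -- A rule of full power must take action `1` almost everywhere on `0 < h`; this one does so only
  -- there.
  obtain ⟨δ, hδ, -⟩ := exists_threshold_rule H.measurable 0
  have hδh : ∀ x, power δ x * h x = 1 * h x := fun x => by
    rw [hδ]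
    rcases (H.mem x).1.eq_or_lt with hx | hx
    · simp [← hx]
    · simp [hx]
  have hint : ∫ x, 1 * h x ∂(μ + ν) = 1 := by rw [← H.integral_right fun _ => 1]; simp
  refine ⟨δ, by rw [rejProb, H.integral_right]; simpa only [hδh] using hint, fun τ hτ => ?_⟩
  have j := fun δ => by
    simpa only [neg_mul, one_mul, sub_neg_eq_add, zero_add] using H.integrable_mul δ 0 (-1)
  have i := fun δ => by simpa only [one_mul] using H.integrable_mul δ 1 1
  rw [rejProb, H.integral_right, ← hint] at hτ
  simp only [← hδh] at hτ
  have hae := (integral_eq_iff_of_ae_le (j τ) (j δ) (.of_forall fun x => by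
    simpa only [hδh x] using mul_le_mul_of_nonneg_right (power_mem τ x).2 (H.mem x).1)).1 hτ
  rw [rejProb, rejProb, H.integral_left, H.integral_left (power τ)]
  refine integral_mono_ae (i δ) (i τ) ?_
  filter_upwards [hae] with x hx
  refine mul_le_mul_of_nonneg_right ?_ (sub_nonneg.2 (H.mem x).2)
  simp only [hδh] at hx
  rcases (H.mem x).1.eq_or_lt with h0 | h0
  · simpa [hδ, ← h0] using (power_mem τ x).1
  · rw [mul_right_cancel₀ h0.ne' hx]
    exact (power_mem δ x).2

/-- If the statistic is not sufficient for the pair, then for some positive weights its rules stay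
away from the minimal weighted error. -/
theorem exists_gap_of_not_isPairSufficient {μ ν : Measure X} [IsProbabilityMeasure μ]
    [IsProbabilityMeasure ν] {κ : Kernel X 𝓣} [IsMarkovKernel κ]
    (hκ : ¬ IsPairSufficient μ ν κ) :
    ∃ s ∈ Set.Ioo (0 : ℝ) 1, ∃ ρ : DecisionRule X (Fin 2),
      (∀ δ, weightedError μ ν s ρ ≤ weightedError μ ν s δ) ∧
      ∃ ε > 0, ∀ σ : DecisionRule 𝓣 (Fin 2),
        weightedError μ ν s ρ + ε ≤ weightedError (κ ∘ₘ μ) (κ ∘ₘ ν) s σ := by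
  contrapose! hκ
  obtain ⟨h, H⟩ := exists_isLikelihood μ ν
  obtain ⟨g, G⟩ := exists_isLikelihood (κ ∘ₘ μ) (κ ∘ₘ ν)
  have hs : ∀ s ∈ Set.Ioo (0 : ℝ) 1, ∀ᵐ x ∂(μ + ν),
      (s < h x → ∀ᵐ t ∂κ x, s < g t) ∧ (h x < s → ∀ᵐ t ∂κ x, g t ≤ s) := by
    intro s hs
    obtain ⟨ρ, -, hρ⟩ := exists_threshold_rule H.measurable s
    obtain ⟨σ, hσ1, hσ⟩ := exists_threshold_rule G.measurable s
    have := σ.2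
    -- The threshold test in `g` attains the least error among tests through `κ`, so the absence of
    -- a positive gap makes it optimal among all tests.
    have hle : weightedError (κ ∘ₘ μ) (κ ∘ₘ ν) s σ ≤ weightedError μ ν s ρ := by
      by_contra! hlt
      obtain ⟨τ, hτ⟩ := hκ s hs ρ (weightedError_le_of_power_mul H hρ) _ (sub_pos.2 hlt)
      linarith [weightedError_le_of_power_mul G hσ τ]
    set δ : DecisionRule X (Fin 2) := ⟨σ.1 ∘ₖ κ, inferInstance⟩ with hδ
    rw [weightedError, ← rejProb_of_eq_comp μ (δ := δ) rfl, ← rejProb_of_eq_comp ν (δ := δ) rfl]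
      at hle
    have hms : MeasurableSet {t | s < g t} := measurableSet_lt measurable_const G.measurable
    have hpow : ∀ x, power δ x = (κ x).real {t | s < g t} := fun x => by
      rw [← integral_indicator_one hms, ← hσ1]
      change ((σ.1 ∘ₖ κ) x).real {1} = rejProb (κ x) σ
      rw [rejProb_eq_comp, Kernel.comp_apply]
    filter_upwards [power_mul_ae_eq_of_weightedError_le H hρ hle] with x hx
    rw [hpow] at hx
    constructor
    · intro hlt
      rw [min_eq_left (by linarith)] at hx
      have : (κ x).real {t | s < g t} = 1 :=
        mul_right_cancel₀ (sub_neg.2 hlt).ne (by rw [hx, one_mul])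
      exact (mem_ae_iff_prob_eq_one hms).2 ((ENNReal.toReal_eq_one_iff _).1 this)
    · intro hlt
      rw [min_eq_right (by linarith)] at hx
      have := (mul_eq_zero.1 hx).resolve_right (sub_pos.2 hlt).ne'
      rw [measureReal_eq_zero_iff, measure_eq_zero_iff_ae_notMem] at this
      filter_upwards [this] with t ht
      exact not_lt.1 ht
  have hgh : ∀ᵐ z ∂((μ + ν) ⊗ₘ κ), h z.1 = g z.2 := by
    have hh := H.measurable
    have hg := G.measurable
    rw [Measure.ae_compProd_iff (measurableSet_eq_fun (f := fun z => h z.1) (g := fun z => g z.2)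
      (by fun_prop) (by fun_prop))]
    -- Countably many thresholds keep the exceptional set null, and a rational strictly between `h
    -- x` and `g t` contradicts one of the two implications.
    have hq : ∀ᵐ x ∂(μ + ν), ∀ q : ℚ, (q : ℝ) ∈ Set.Ioo (0 : ℝ) 1 →
        ((q < h x → ∀ᵐ t ∂κ x, q < g t) ∧ (h x < q → ∀ᵐ t ∂κ x, g t ≤ q)) := by
      rw [ae_all_iff]
      intro q
      by_cases hq : (q : ℝ) ∈ Set.Ioo (0 : ℝ) 1
      · filter_upwards [hs q hq] with x hx _ using hx
      · exact .of_forall fun x hx => absurd hx hq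
    filter_upwards [hq] with x hx
    have : ∀ᵐ t ∂κ x, ∀ q : ℚ, (q : ℝ) ∈ Set.Ioo (0 : ℝ) 1 →
        ((q < h x → q < g t) ∧ (h x < q → g t ≤ q)) := by
      rw [ae_all_iff]
      intro q
      by_cases hq : (q : ℝ) ∈ Set.Ioo (0 : ℝ) 1
      · have e1 : ∀ᵐ t ∂κ x, (q < h x → q < g t) := by
          by_cases hlt : (q : ℝ) < h x
          · filter_upwards [(hx q hq).1 hlt] with t ht _ using ht
          · exact .of_forall fun t h' => absurd h' hlt
        have e2 : ∀ᵐ t ∂κ x, (h x < q → g t ≤ q) := by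
          by_cases hlt : h x < q
          · filter_upwards [(hx q hq).2 hlt] with t ht _ using ht
          · exact .of_forall fun t h' => absurd h' hlt
        filter_upwards [e1, e2] with t h1 h2 _ using ⟨h1, h2⟩
      · exact .of_forall fun t hx => absurd hx hq
    filter_upwards [this] with t ht
    rcases lt_trichotomy (h x) (g t) with hlt | heq | hlt
    · obtain ⟨q, h1, h2⟩ := exists_rat_btwn hlt
      exact absurd ((ht q ⟨(H.mem x).1.trans_lt h1, h2.trans_le (G.mem t).2⟩).2 h1) h2.not_ge
    · exact heq
    · obtain ⟨q, h1, h2⟩ := exists_rat_btwn hlt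
      exact absurd ((ht q ⟨(G.mem t).1.trans_lt h1, h2.trans_le (H.mem x).2⟩).1 h2) h1.not_gt
  have hadd : μ ⊗ₘ κ + ν ⊗ₘ κ = (μ + ν) ⊗ₘ κ := (Measure.compProd_add_left μ ν κ).symm
  refine ⟨fun t => ENNReal.ofReal (g t), G.measurable.ennreal_ofReal, ?_, ?_⟩
  · have : SFinite ((μ + ν).withDensity fun x => ENNReal.ofReal (h x)) := by
      rw [← H.right]; infer_instance
    conv_lhs => rw [H.right]
    rw [hadd, withDensity_compProd H.measurable.ennreal_ofReal]
    refine withDensity_congr_ae ?_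
    filter_upwards [hgh] with z hz
    rw [hz]
  · have : SFinite ((μ + ν).withDensity fun x => ENNReal.ofReal (1 - h x)) := by
      rw [← H.left]; infer_instance
    conv_lhs => rw [H.left]
    rw [hadd, withDensity_compProd H.measurable_ofReal_one_sub]
    refine withDensity_congr_ae ?_
    filter_upwards [hgh] with z hz
    rw [hz, ENNReal.ofReal_sub _ (G.mem z.2).1, ENNReal.ofReal_one]

theorem isPairSufficient_self (μ : Measure X) (κ : Kernel X 𝓣) : IsPairSufficient μ μ κ := by
  have : μ ⊗ₘ κ = (μ ⊗ₘ κ + μ ⊗ₘ κ).withDensity (fun _ => 2⁻¹) := by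
    rw [withDensity_const, smul_add, ← add_smul, ENNReal.inv_two_add_inv_two, one_smul]
  exact ⟨fun _ => 2⁻¹, measurable_const, this, by
    simpa only [ENNReal.one_sub_inv_two] using this⟩

end NeymanPearson

/-! ### The decision problem at two parameters and its admissible rules. -/

section TwoPoint

variable {Θ X 𝓣 : Type*} [MeasurableSpace X] [MeasurableSpace 𝓣]

open Classical in
/-- The loss of the test of `θ₁` against `θ₂`. -/
noncomputable def testLoss (θ₁ θ₂ θ : Θ) (a : Fin 2) : ℝ :=
  if θ = θ₁ then (if a = 1 then 1 else 0) else if θ = θ₂ then (if a = 0 then 1 else 0) else 0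

theorem testLoss_mem (θ₁ θ₂ θ : Θ) (a : Fin 2) : testLoss θ₁ θ₂ θ a ∈ Set.Icc (0 : ℝ) 1 := by
  unfold testLoss
  split_ifs <;> simp

theorem risk_eq (P : Θ → Measure X) (L : Θ → Fin 2 → ℝ) (δ : DecisionRule X (Fin 2)) (θ : Θ) :
    risk P L δ θ = ∫ x, (L θ 0 * (1 - power δ x) + L θ 1 * power δ x) ∂(P θ) := by
  have := δ.2
  refine integral_congr_ae (.of_forall fun x => ?_)
  have h1 : (δ.1 x).real {0} = 1 - power δ x := by
    have : ({0} : Set (Fin 2)) = {1}ᶜ := by ext a; fin_cases a <;> simp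
    rw [this, probReal_compl_eq_one_sub (measurableSet_singleton 1)]
    rfl
  change ∫ a, L θ a ∂(δ.1 x) = _
  rw [integral_fintype .of_finite, Fin.sum_univ_two, h1, smul_eq_mul, smul_eq_mul]
  change _ + power δ x * _ = _
  ring

variable {P : Θ → Measure X} {θ₁ θ₂ : Θ}

theorem risk_testLoss_left (δ : DecisionRule X (Fin 2)) :
    risk P (testLoss θ₁ θ₂) δ θ₁ = rejProb (P θ₁) δ := by
  rw [risk_eq]; simp [testLoss, rejProb]

theorem risk_testLoss_of_ne {θ : Θ} (h₁ : θ ≠ θ₁) (h₂ : θ ≠ θ₂) (δ : DecisionRule X (Fin 2)) :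
    risk P (testLoss θ₁ θ₂) δ θ = 0 := by
  rw [risk_eq]; simp [testLoss, h₁, h₂]

/-- The undominated rules. -/
def admissibleRules {A : Type*} [MeasurableSpace A] (P : Θ → Measure X) (L : Θ → A → ℝ) :
    Set (DecisionRule X A) :=
  {δ | ∀ τ, ¬ Dominates P L τ δ}

/-- Every complete class contains all admissible rules, since nothing can dominate one that is left
out. -/
theorem isMinimalCompleteClass_admissibleRules {A : Type*} [MeasurableSpace A] {L : Θ → A → ℝ}
    (h : IsCompleteClass P L (admissibleRules P L)) :
    IsMinimalCompleteClass P L (admissibleRules P L) := by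
  refine ⟨h, fun C' hC' hc => hC'.antisymm fun δ hδ => ?_⟩
  by_contra hn
  obtain ⟨τ, -, hτ⟩ := hc δ hn
  exact hδ τ hτ

theorem Dominates.trans_le {A : Type*} [MeasurableSpace A] {L : Θ → A → ℝ}
    {δ₁ δ₂ δ₃ : DecisionRule X A} (h : ∀ θ, risk P L δ₁ θ ≤ risk P L δ₂ θ)
    (h' : Dominates P L δ₂ δ₃) : Dominates P L δ₁ δ₃ :=
  ⟨fun θ => (h θ).trans (h'.1 θ), h'.2.imp fun θ hθ => (h θ).trans_lt hθ⟩

variable [∀ θ, IsProbabilityMeasure (P θ)]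

theorem risk_testLoss_right (hne : θ₁ ≠ θ₂) (δ : DecisionRule X (Fin 2)) :
    risk P (testLoss θ₁ θ₂) δ θ₂ = 1 - rejProb (P θ₂) δ := by
  rw [risk_eq]
  simp [testLoss, rejProb, hne.symm, integral_sub (integrable_const (1 : ℝ))
    (integrable_power (P θ₂) δ)]

theorem risk_testLoss_le_iff (hne : θ₁ ≠ θ₂) (δ δ' : DecisionRule X (Fin 2)) :
    (∀ θ, risk P (testLoss θ₁ θ₂) δ θ ≤ risk P (testLoss θ₁ θ₂) δ' θ) ↔
      rejProb (P θ₁) δ ≤ rejProb (P θ₁) δ' ∧ rejProb (P θ₂) δ' ≤ rejProb (P θ₂) δ := by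
  constructor
  · intro h
    have h1 := h θ₁
    have h2 := h θ₂
    rw [risk_testLoss_left, risk_testLoss_left] at h1
    rw [risk_testLoss_right hne, risk_testLoss_right hne] at h2
    exact ⟨h1, by linarith⟩
  · rintro ⟨h1, h2⟩ θ
    by_cases e1 : θ = θ₁
    · rwa [e1, risk_testLoss_left, risk_testLoss_left]
    by_cases e2 : θ = θ₂
    · rw [e2, risk_testLoss_right hne, risk_testLoss_right hne]
      linarith
    rw [risk_testLoss_of_ne e1 e2, risk_testLoss_of_ne e1 e2]

theorem dominates_testLoss_iff (hne : θ₁ ≠ θ₂) (δ δ' : DecisionRule X (Fin 2)) :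
    Dominates P (testLoss θ₁ θ₂) δ δ' ↔
      (rejProb (P θ₁) δ ≤ rejProb (P θ₁) δ' ∧ rejProb (P θ₂) δ' ≤ rejProb (P θ₂) δ) ∧
        (rejProb (P θ₁) δ < rejProb (P θ₁) δ' ∨ rejProb (P θ₂) δ' < rejProb (P θ₂) δ) := by
  rw [Dominates, risk_testLoss_le_iff hne]
  refine and_congr_right fun _ => ⟨?_, ?_⟩
  · rintro ⟨θ, hθ⟩
    by_cases e1 : θ = θ₁
    · rw [e1, risk_testLoss_left, risk_testLoss_left] at hθ
      exact Or.inl hθ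
    by_cases e2 : θ = θ₂
    · rw [e2, risk_testLoss_right hne, risk_testLoss_right hne] at hθ
      exact Or.inr (by linarith)
    rw [risk_testLoss_of_ne e1 e2, risk_testLoss_of_ne e1 e2] at hθ
    exact absurd hθ (lt_irrefl _)
  · rintro (h | h)
    · exact ⟨θ₁, by rwa [risk_testLoss_left, risk_testLoss_left]⟩
    · exact ⟨θ₂, by rw [risk_testLoss_right hne, risk_testLoss_right hne]; linarith⟩

/-- The prior that gives the weights `s` and `1 - s` to `θ₁` and `θ₂`. -/
theorem exists_twoPointPrior (P : Θ → Measure X) [∀ θ, IsProbabilityMeasure (P θ)]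
    (hne : θ₁ ≠ θ₂) {s : ℝ} (hs : s ∈ Set.Icc (0 : ℝ) 1) :
    ∃ π : PMF Θ, π.support ⊆ {θ₁, θ₂} ∧ (s ∈ Set.Ioo (0 : ℝ) 1 → π.support = {θ₁, θ₂}) ∧
      ∀ δ : DecisionRule X (Fin 2), priorRisk P (testLoss θ₁ θ₂) π δ =
        weightedError (P θ₁) (P θ₂) s δ := by
  classical
  set w : Θ → ℝ≥0∞ := fun θ => if θ = θ₁ then ENNReal.ofReal s else
    if θ = θ₂ then ENNReal.ofReal (1 - s) else 0 with hw
  have w1 : w θ₁ = ENNReal.ofReal s := by simp [hw]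
  have w2 : w θ₂ = ENNReal.ofReal (1 - s) := by simp [hw, hne.symm]
  have w0 : ∀ θ, θ ∉ ({θ₁, θ₂} : Finset Θ) → w θ = 0 := fun θ h => by
    simp only [Finset.mem_insert, Finset.mem_singleton, not_or] at h
    simp [hw, h.1, h.2]
  have hsum : ∑ θ ∈ ({θ₁, θ₂} : Finset Θ), w θ = 1 := by
    rw [Finset.sum_pair hne, w1, w2, ← ENNReal.ofReal_add hs.1 (sub_nonneg.2 hs.2)]
    simp
  set π : PMF Θ := PMF.ofFinset w {θ₁, θ₂} hsum w0 with hπ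
  have hπw : ∀ θ, π θ = w θ := fun θ => rfl
  have hsub : π.support ⊆ {θ₁, θ₂} := fun θ hθ => by
    by_contra hn
    exact hθ ((hπw θ).trans (w0 θ (by simpa using hn)))
  refine ⟨π, hsub, fun hs' => hsub.antisymm ?_, fun δ => ?_⟩
  · rintro θ (rfl | rfl) <;> rw [PMF.mem_support_iff, hπw]
    · simpa [w1] using hs'.1
    · simpa [w2] using hs'.2
  · rw [priorRisk, tsum_eq_sum (s := {θ₁, θ₂}) fun θ hθ => by rw [hπw, w0 θ hθ]; simp,
      Finset.sum_pair hne, hπw, hπw, w1, w2, ENNReal.toReal_ofReal hs.1,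
      ENNReal.toReal_ofReal (sub_nonneg.2 hs.2), risk_testLoss_left, risk_testLoss_right hne,
      weightedError]

/-- A dominating rule is improved to a most powerful one of its level. That one is admissible unless
its power is `1`; then a full-power rule of least level takes its place. -/
theorem isCompleteClass_admissibleRules (hne : θ₁ ≠ θ₂) :
    IsCompleteClass P (testLoss θ₁ θ₂) (admissibleRules P (testLoss θ₁ θ₂)) := by
  intro δ hδ
  simp only [admissibleRules, Set.mem_ofPred_eq, not_forall, not_not] at hδ
  obtain ⟨τ, hτ⟩ := hδ
  obtain ⟨η, hη, hmax, -⟩ := exists_most_powerful (P θ₁) (P θ₂) (rejProb_mem (P θ₁) τ)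
  rcases (rejProb_mem (P θ₂) η).2.lt_or_eq with h1 | h1
  · refine ⟨η, fun ξ hξ => ?_, Dominates.trans_le ((risk_testLoss_le_iff hne _ _).2
      ⟨hη.le, hmax τ rfl⟩) hτ⟩
    exact not_better_of_maximal (fun ξ h => hmax ξ (h.trans hη)) h1 ξ
      ((dominates_testLoss_iff hne _ _).1 hξ)
  · obtain ⟨ζ, hζ, hmin⟩ := exists_full_power (P θ₁) (P θ₂)
    refine ⟨ζ, fun ξ hξ => ?_, Dominates.trans_le ((risk_testLoss_le_iff hne _ _).2
      ⟨(hmin η h1).trans hη.le, ?_⟩) hτ⟩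
    · rw [dominates_testLoss_iff hne] at hξ
      have h2 : rejProb (P θ₂) ξ = 1 := le_antisymm (rejProb_mem _ ξ).2 (hζ ▸ hξ.1.2)
      rcases hξ.2 with h | h
      · exact (hmin ξ h2).not_gt h
      · rw [h2, hζ] at h
        exact lt_irrefl _ h
    · rw [hζ]
      exact (rejProb_mem _ τ).2

/-- An admissible rule shares its level and power with a Neyman–Pearson test, which is Bayes. The
weight may be `0` or `1`, so the prior may sit at one parameter. -/
theorem exists_weight_of_mem_admissibleRules (hne : θ₁ ≠ θ₂) {δ : DecisionRule X (Fin 2)}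
    (hδ : δ ∈ admissibleRules P (testLoss θ₁ θ₂)) :
    ∃ s ∈ Set.Icc (0 : ℝ) 1, ∀ δ',
      weightedError (P θ₁) (P θ₂) s δ ≤ weightedError (P θ₁) (P θ₂) s δ' := by
  obtain ⟨η, hη, hmax, s, hs, hB⟩ :=
    exists_most_powerful (P θ₁) (P θ₂) (rejProb_mem (P θ₁) δ)
  have heq : rejProb (P θ₂) δ = rejProb (P θ₂) η := by
    refine (hmax δ rfl).eq_of_not_lt fun hlt => hδ η ?_
    exact (dominates_testLoss_iff hne _ _).2 ⟨⟨hη.le, hlt.le⟩, Or.inr hlt⟩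
  refine ⟨s, hs, fun δ' => ?_⟩
  rw [weightedError, heq, ← hη]
  exact hB δ'

/-- Both weights are positive, so a dominating rule would lower the weighted error. -/
theorem mem_admissibleRules_of_weightedError_le (hne : θ₁ ≠ θ₂) {s : ℝ}
    (hs : s ∈ Set.Ioo (0 : ℝ) 1) {ρ : DecisionRule X (Fin 2)}
    (hρ : ∀ δ, weightedError (P θ₁) (P θ₂) s ρ ≤ weightedError (P θ₁) (P θ₂) s δ) :
    ρ ∈ admissibleRules P (testLoss θ₁ θ₂) := by
  intro τ hτ
  rw [dominates_testLoss_iff hne] at hτ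
  have h := hρ τ
  rw [weightedError, weightedError] at h
  obtain ⟨h0, h1⟩ := hs
  obtain ⟨⟨ha, hb⟩, hlt | hlt⟩ := hτ <;> nlinarith

/-- A non-sufficient statistic is not enough for some test of two parameters: there is a Bayes
rule for a prior on them that beats all rules through the statistic. -/
theorem exists_test_of_not_isSufficient [Nonempty Θ] [StandardBorelSpace X] (hP : IsDominated P)
    (κ : Kernel X 𝓣) [IsMarkovKernel κ] (hκ : ¬ IsSufficient P κ) :
    ∃ (k : ℕ) (L : Θ → Fin k → ℝ), (∀ θ a, L θ a ∈ Set.Icc (0 : ℝ) 1) ∧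
      ¬ IsEssentiallyCompleteClass P L (proceduresThrough κ (Fin k)) ∧
      ∃ (π : PMF Θ) (ρ : DecisionRule X (Fin k)) (C : Set (DecisionRule X (Fin k))),
        IsBayesRule P L π ρ ∧
        (∃ ε > 0, ∀ σ ∈ proceduresThrough κ (Fin k),
          priorRisk P L π ρ + ε ≤ priorRisk P L π σ) ∧
        IsMinimalCompleteClass P L C ∧ ρ ∈ C ∧
        (∀ δ ∈ C, ∃ π' : PMF Θ, π'.support ⊆ π.support ∧ IsBayesRule P L π' δ) ∧
        ∃ σ ∈ proceduresThrough κ (Fin k),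
          (∀ τ ∈ proceduresThrough κ (Fin k), ¬ Dominates P L τ σ) ∧
          σ ∉ C ∧ Dominates P L ρ σ := by
  obtain ⟨θ₁, θ₂, h12⟩ : ∃ θ₁ θ₂, ¬ IsPairSufficient (P θ₁) (P θ₂) κ := by
    by_contra! h
    exact hκ (isSufficient_of_pairs hP κ h)
  have hne : θ₁ ≠ θ₂ := by
    rintro rfl
    exact h12 (isPairSufficient_self _ _)
  obtain ⟨s, hs, ρ, hρ, ε, hε, hgap⟩ := exists_gap_of_not_isPairSufficient h12
  have hgap' : ∀ σ ∈ proceduresThrough κ (Fin 2),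
      weightedError (P θ₁) (P θ₂) s ρ + ε ≤ weightedError (P θ₁) (P θ₂) s σ := by
    rintro σ ⟨σ', hσ'⟩
    have := hgap σ'
    rw [weightedError.eq_def (κ ∘ₘ P θ₁), ← rejProb_of_eq_comp _ hσ',
      ← rejProb_of_eq_comp _ hσ'] at this
    exact this
  have hs' := Set.Ioo_subset_Icc_self hs
  obtain ⟨π, -, hπ, hπr⟩ := exists_twoPointPrior P hne hs'
  have hρC := mem_admissibleRules_of_weightedError_le hne hs hρ
  refine ⟨2, testLoss θ₁ θ₂, testLoss_mem θ₁ θ₂, fun hess => ?_, π, ρ,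
    admissibleRules P (testLoss θ₁ θ₂), fun δ => ?_, ⟨ε, hε, fun σ hσ => ?_⟩,
    isMinimalCompleteClass_admissibleRules (isCompleteClass_admissibleRules hne), hρC,
    fun δ hδ => ?_, ?_⟩
  · obtain ⟨τ, hτ, hle⟩ := hess ρ fun hmem => by linarith [hgap' ρ hmem]
    have h := hgap' τ hτ
    obtain ⟨h1, h2⟩ := (risk_testLoss_le_iff hne _ _).1 hle
    rw [weightedError, weightedError] at h
    nlinarith [hs.1, hs.2]
  · rw [hπr, hπr]; exact hρ δ
  · rw [hπr, hπr]; exact hgap' σ hσ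
  · obtain ⟨t, ht, hB⟩ := exists_weight_of_mem_admissibleRules hne hδ
    obtain ⟨π', hπ', -, hπr'⟩ := exists_twoPointPrior P hne ht
    refine ⟨π', hπ hs ▸ hπ', fun δ' => ?_⟩
    rw [hπr', hπr']
    exact hB δ'
  -- Take the most powerful test through `κ` at the level of `ρ`. With equal levels the gap must
  -- appear in the power, so `ρ` dominates it; its power is thus below `1`, which makes it
  -- undominated among tests through `κ`.
  · obtain ⟨σ', hσ', hmax, -⟩ :=
      exists_most_powerful (κ ∘ₘ P θ₁) (κ ∘ₘ P θ₂) (rejProb_mem (P θ₁) ρ)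
    have := σ'.2
    set σ : DecisionRule X (Fin 2) := ⟨σ'.1 ∘ₖ κ, inferInstance⟩
    have hσ : σ ∈ proceduresThrough κ (Fin 2) := ⟨σ', rfl⟩
    have e : ∀ θ, rejProb (P θ) σ = rejProb (κ ∘ₘ P θ) σ' := fun θ => rejProb_of_eq_comp _ rfl
    have hlt : rejProb (P θ₂) σ < rejProb (P θ₂) ρ := by
      have h := hgap' σ hσ
      rw [weightedError, weightedError, e θ₁, hσ'] at h
      nlinarith [hs.2]
    have hdom : Dominates P (testLoss θ₁ θ₂) ρ σ :=
      (dominates_testLoss_iff hne _ _).2 ⟨⟨by rw [e, hσ'], hlt.le⟩, Or.inr hlt⟩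
    refine ⟨σ, hσ, ?_, fun hσC => hσC ρ hdom, hdom⟩
    rintro τ ⟨τ', hτ'⟩ hτ
    rw [dominates_testLoss_iff hne, e, e, rejProb_of_eq_comp _ hτ', rejProb_of_eq_comp _ hτ'] at hτ
    refine not_better_of_maximal (fun ξ h => hmax ξ (h.trans hσ')) ?_ τ' hτ
    rw [← e]
    exact hlt.trans_le (rejProb_mem _ ρ).2

end TwoPoint

end Conformal

theorem mainTheorem8 {Θ 𝓨 𝓣 : Type*} [Nonempty Θ] [MeasurableSpace 𝓨] [StandardBorelSpace 𝓨]
    [MeasurableSpace 𝓣] {n m : ℕ}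
    (P : Θ → Measure (Fin n → 𝓨)) [∀ θ, IsProbabilityMeasure (P θ)] (hP : IsDominated P)
    (S : (Fin n → 𝓨) → Fin m → ℝ) (hS : Measurable S)
    (K : Kernel (Fin m → ℕ) 𝓣) [IsMarkovKernel K]
    (hT : ¬ IsSufficient P (rankReduction S hS K)) :
    ∃ (k : ℕ) (L : Θ → Fin k → ℝ), (∀ θ a, L θ a ∈ Set.Icc (0 : ℝ) 1) ∧
      -- the rank-based procedures are not even an essentially complete class
      ¬ IsEssentiallyCompleteClass P L (proceduresThrough (rankReduction S hS K) (Fin k)) ∧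
      ∃ (π : PMF Θ) (ρ : DecisionRule (Fin n → 𝓨) (Fin k)) (C : Set (DecisionRule _ (Fin k))),
        -- a Bayes procedure whose Bayes risk is smaller than that of every rank-based procedure
        IsBayesRule P L π ρ ∧
        (∃ ε > 0, ∀ σ ∈ proceduresThrough (rankReduction S hS K) (Fin k),
          priorRisk P L π ρ + ε ≤ priorRisk P L π σ) ∧
        -- it belongs to the minimal complete class, which consists of Bayes procedures
        IsMinimalCompleteClass P L C ∧ ρ ∈ C ∧
        (∀ δ ∈ C, ∃ π' : PMF Θ, π'.support ⊆ π.support ∧ IsBayesRule P L π' δ) ∧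
        -- a rank-based procedure that no rank-based procedure dominates lies outside that class
        -- and is dominated by the Bayes procedure
        ∃ σ ∈ proceduresThrough (rankReduction S hS K) (Fin k),
          (∀ τ ∈ proceduresThrough (rankReduction S hS K) (Fin k), ¬ Dominates P L τ σ) ∧
          σ ∉ C ∧ Dominates P L ρ σ := by
  have : IsMarkovKernel (rankReduction S hS K) := by
    unfold rankReduction
    infer_instance
  exact exists_test_of_not_isSufficient hP _ hT
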